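/- Let $1<p<\infty$, let $\mathbb T$ be the unit circle with normalized arc length measure, $L^p=L^p(\mathbb T)$, let $H^p\subset L^p$ be the Hardy space (the functions whose Fourier coefficients of negative index vanish) and $K^p\subset L^p$ the subspace of functions whose Fourier coefficients of nonnegative index vanish, so that $L^p=H^p\dotplus K^p$, and let $\mathbb P$ be the Riesz projection of $L^p$ onto $H^p$ along $K^p$. Let $\mathrm{Rat}_0(\mathbb T)$ be the space of strictly proper rational functions all of whose poles lie on $\mathbb T$. For a rational function $\omega\in\mathbb C(z)$, possibly with poles on $\mathbb T$, let $T_\omega$ be the (in general unbounded) operator in $H^p$ given by $$\mathrm{Dom}(T_\omega)=\{g\in H^p \mid \omega g=f+\rho \text{ on } \mathbb T \text{ with } f\in L^p,\ \rho\in \mathrm{Rat}_0(\mathbb T)\},\qquad T_\omega g=\mathbb P f .$$ **Theorem.** Let $\omega\in\mathbb C(z)$, and let $M$ be the largest order of a pole of $\omega$ on $\mathbb T$ (with $M=0$ if $\omega$ has no pole on $\mathbb T$). Then every monomial $z^n$, $n\ge 0$, lies in $\mathrm{Dom}(T_\omega)$, and the matrix of $T_\omega$ with respect to the standard basis $\{z^n\}_{n=0}^\infty$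 of $H^p$ is a Toeplitz matrix: there is a sequence $(a_k)_{k\in\mathbb Z}$ of complex numbers such that for every $n\ge 0$ $$T_\omega z^n=\sum_{m=0}^\infty a_{m-n}\,z^m,$$ the series converging in the norm of $H^p$. Moreover, $a_{-j}=O(j^{M-1})$ for $j\ge 1$, that is, there is a constant $C$ with $|a_{-j}|\le C\,j^{M-1}$ for all $j\ge 1$, and $(a_j)_{j=0}^\infty\in\ell^2$. -/

import Mathlib

open MeasureTheory Filter Topology Polynomial AddCircle
open scoped ENNReal

namespace ToeplitzLike

noncomputable section

/-! ### The spaces `L^p(𝕋)`, `H^p`, `K^p`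

The unit circle is parametrized by `UnitAddCircle = ℝ / ℤ` through `t ↦ toCircle t = exp (2 π i t)`
and carries the normalized Haar (arc length) measure. -/

/-- `L^p(𝕋)`. -/
abbrev LpT (p : ℝ≥0∞) : Type := Lp ℂ p (haarAddCircle (T := 1))

theorem LpT.integrable {p : ℝ≥0∞} [Fact (1 ≤ p)] (f : LpT p) :
    Integrable f (haarAddCircle (T := 1)) :=
  (Lp.memLp f).integrable Fact.out

/-- The `n`-th Fourier coefficient as a linear functional on `L^p(𝕋)`. -/
def coeffL (p : ℝ≥0∞) [Fact (1 ≤ p)] (n : ℤ) : LpT p →ₗ[ℂ] ℂ where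
  toFun f := fourierCoeff f n
  map_add' f g := by
    have h : fourierCoeff (T := 1) (⇑(f + g)) n = fourierCoeff (⇑f + ⇑g) n :=
      integral_congr_ae ((Lp.coeFn_add f g).mono fun t ht => by
        simp only [ht])
    rw [h, fourierCoeff.add f.integrable g.integrable]; rfl
  map_smul' c f := by
    have h : fourierCoeff (T := 1) (⇑(c • f)) n = fourierCoeff (c • ⇑f) n :=
      integral_congr_ae ((Lp.coeFn_smul c f).mono fun t ht => by
        simp only [ht])
    rw [h, fourierCoeff.const_smul]; rfl

/-- The Hardy space `H^p`, identified through boundary values with the space of those functions in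
`L^p(𝕋)` whose Fourier coefficients of negative index vanish. -/
def Hardy (p : ℝ≥0∞) [Fact (1 ≤ p)] : Submodule ℂ (LpT p) :=
  ⨅ n : {n : ℤ // n < 0}, LinearMap.ker (coeffL p n)

/-- The standard complement `K^p` of `H^p` in `L^p(𝕋)`: the functions whose Fourier coefficients of
nonnegative index vanish. -/
def HardyCompl (p : ℝ≥0∞) [Fact (1 ≤ p)] : Submodule ℂ (LpT p) :=
  ⨅ n : {n : ℤ // 0 ≤ n}, LinearMap.ker (coeffL p n)

theorem mem_hardy {p : ℝ≥0∞} [Fact (1 ≤ p)] {f : LpT p} :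
    f ∈ Hardy p ↔ ∀ n : ℤ, n < 0 → fourierCoeff f n = 0 := by
  simp [Hardy, coeffL]

theorem mem_hardyCompl {p : ℝ≥0∞} [Fact (1 ≤ p)] {f : LpT p} :
    f ∈ HardyCompl p ↔ ∀ n : ℤ, 0 ≤ n → fourierCoeff f n = 0 := by
  simp [HardyCompl, coeffL]

/-- An integrable function on the circle all of whose Fourier coefficients vanish is zero. -/
theorem ae_eq_zero_of_fourierCoeff {f : UnitAddCircle → ℂ}
    (hf : Integrable f (haarAddCircle (T := 1))) (h : ∀ n, fourierCoeff f n = 0) :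
    f =ᵐ[haarAddCircle] 0 := by
  have hint : ∀ φ : C(UnitAddCircle, ℂ), Integrable (fun t => φ t * f t) haarAddCircle := fun φ =>
    hf.bdd_mul (c := ‖φ‖) φ.continuous.aestronglyMeasurable
      (ae_of_all _ fun t => φ.norm_coe_le_norm t)
  let Λ : C(UnitAddCircle, ℂ) →ₗ[ℂ] ℂ :=
    { toFun := fun φ => ∫ t, φ t * f t ∂haarAddCircle
      map_add' := fun φ ψ => by
        rw [← integral_add (hint φ) (hint ψ)]
        simp [add_mul]
      map_smul' := fun c φ => by
        simp [mul_assoc, integral_const_mul] }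
  let Λc : C(UnitAddCircle, ℂ) →L[ℂ] ℂ := Λ.mkContinuous (∫ t, ‖f t‖ ∂haarAddCircle) (fun φ => by
    rw [← integral_mul_const]
    refine norm_integral_le_of_norm_le (hf.norm.mul_const _) (ae_of_all _ fun t => ?_)
    rw [norm_mul, mul_comm]
    gcongr
    exact φ.norm_coe_le_norm t)
  have hall : ∀ φ : C(UnitAddCircle, ℂ), ∫ t, φ t * f t ∂haarAddCircle = 0 := by
    have hle : (Submodule.span ℂ (Set.range (@fourier 1))).topologicalClosure
        ≤ LinearMap.ker Λc.toLinearMap := by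
      refine Submodule.topologicalClosure_minimal _ ?_ Λc.isClosed_ker
      rw [Submodule.span_le]
      rintro _ ⟨n, rfl⟩
      have := h (-n)
      simpa [fourierCoeff, Λc, Λ] using this
    intro φ
    rw [span_fourier_closure_eq_top] at hle
    exact hle (Submodule.mem_top (x := φ))
  refine ae_eq_zero_of_forall_setIntegral_isClosed_eq_zero hf fun s hs => ?_
  have hs' := hs.measurableSet
  let g : ℕ → UnitAddCircle → ℂ := fun n t => ((hs.apprSeq n t : NNReal) : ℝ) * f t
  have hlim : Tendsto (fun n => ∫ t, g n t ∂haarAddCircle) atTop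
      (𝓝 (∫ t, s.indicator f t ∂haarAddCircle)) := by
    refine tendsto_integral_of_dominated_convergence (fun t => ‖f t‖) (fun n => ?_) hf.norm
      (fun n => ae_of_all _ fun t => ?_) (ae_of_all _ fun t => ?_)
    · refine AEStronglyMeasurable.mul ?_ hf.aestronglyMeasurable
      exact (Complex.continuous_ofReal.comp (NNReal.continuous_coe.comp
        (hs.apprSeq n).continuous)).aestronglyMeasurable
    · have h1 : ((hs.apprSeq n t : NNReal) : ℝ) ≤ 1 := by
        exact_mod_cast HasOuterApproxClosed.apprSeq_apply_le_one hs n t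
      simp only [g, norm_mul, Complex.norm_real, Real.norm_eq_abs, NNReal.abs_eq]
      exact mul_le_of_le_one_left (norm_nonneg _) h1
    · have h2 := (tendsto_pi_nhds.1 (HasOuterApproxClosed.tendsto_apprSeq hs)) t
      have h3 : Tendsto (fun n => g n t) atTop
          (𝓝 ((((s.indicator (fun _ => (1 : NNReal)) t : NNReal) : ℝ) : ℂ) * f t)) :=
        ((Complex.continuous_ofReal.comp NNReal.continuous_coe).continuousAt.tendsto.comp
          h2).mul_const _
      convert h3 using 2
      by_cases ht : t ∈ s <;> simp [ht]
  have hz : ∀ n, ∫ t, g n t ∂haarAddCircle = 0 := fun n =>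
    hall ⟨fun t => (((hs.apprSeq n t : NNReal) : ℝ) : ℂ), Complex.continuous_ofReal.comp
      (NNReal.continuous_coe.comp (hs.apprSeq n).continuous)⟩
  simp only [hz] at hlim
  rw [← integral_indicator hs']
  exact (tendsto_nhds_unique hlim tendsto_const_nhds)

theorem hardy_disjoint (p : ℝ≥0∞) [Fact (1 ≤ p)] : Disjoint (Hardy p) (HardyCompl p) := by
  rw [Submodule.disjoint_def]
  intro f h1 h2
  rw [mem_hardy] at h1
  rw [mem_hardyCompl] at h2
  refine Lp.eq_zero_iff_ae_eq_zero.2 (ae_eq_zero_of_fourierCoeff f.integrable fun n => ?_)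
  rcases lt_or_ge n 0 with hn | hn
  exacts [h1 n hn, h2 n hn]

/-- `P` is a linear map `L^p(𝕋) → H^p` that is the identity on `H^p` and zero on `K^p`. -/
def IsRiesz {p : ℝ≥0∞} [Fact (1 ≤ p)] (P : LpT p →ₗ[ℂ] Hardy p) : Prop :=
  (∀ h : Hardy p, P h = h) ∧ ∀ k ∈ HardyCompl p, P k = 0

theorem exists_isRiesz (p : ℝ≥0∞) [Fact (1 ≤ p)] :
    ∃ P : LpT p →ₗ[ℂ] Hardy p, IsRiesz P := by
  obtain ⟨q, hq, hc⟩ := (hardy_disjoint p).symm.exists_isCompl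
  exact ⟨(Hardy p).projectionOnto q hc.symm, fun h => Submodule.projectionOnto_apply_left _ h,
    fun k hk => (Submodule.projectionOnto_apply_eq_zero_iff _).2 (hq hk)⟩

/-- The Riesz projection `ℙ` of `L^p(𝕋)` onto `H^p` along `K^p`. For `1 < p < ∞` one has
`L^p(𝕋) = H^p ⊕ K^p`, so that it is the only map with the two defining properties. -/
def rieszProj (p : ℝ≥0∞) [Fact (1 ≤ p)] : LpT p →ₗ[ℂ] Hardy p :=
  (exists_isRiesz p).choose

theorem rieszProj_spec (p : ℝ≥0∞) [Fact (1 ≤ p)] : IsRiesz (rieszProj p) :=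
  (exists_isRiesz p).choose_spec

/-! ### Rational functions -/

/-- The restriction of a rational function to the circle (with the value `0` at the finitely many
poles). -/
def onCircle (ω : RatFunc ℂ) (t : UnitAddCircle) : ℂ :=
  ω.eval (RingHom.id ℂ) (toCircle t)

theorem ae_eval_ne_zero {q : ℂ[X]} (hq : q ≠ 0) :
    ∀ᵐ t ∂(haarAddCircle (T := 1)), q.eval (toCircle t : ℂ) ≠ 0 := by
  have hinj : Function.Injective (fun t : UnitAddCircle => (toCircle t : ℂ)) :=
    Subtype.val_injective.comp (injective_toCircle one_ne_zero)
  have hfin : {t : UnitAddCircle | q.eval (toCircle t : ℂ) = 0}.Finite := by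
    have h := (q.finite_setOfPred_isRoot hq).preimage (f := fun t : UnitAddCircle => (toCircle t : ℂ))
      hinj.injOn
    exact h
  have hball : ∀ x : UnitAddCircle, haarAddCircle (T := 1) {x} = 0 := fun x => by
    have h0 := AddCircle.volume_closedBall 1 (x := x) 0
    rw [volume_eq_smul_haarAddCircle] at h0
    simpa using h0
  rw [ae_iff]
  simp only [ne_eq, not_not]
  rw [← Set.biUnion_of_singleton {t : UnitAddCircle | q.eval (toCircle t : ℂ) = 0},
    measure_biUnion_null_iff hfin.countable]
  exact fun x _ => hball x

theorem eval_div {s q : ℂ[X]} {z : ℂ} (hz : q.eval z ≠ 0) :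
    (algebraMap ℂ[X] (RatFunc ℂ) s / algebraMap ℂ[X] (RatFunc ℂ) q).eval (RingHom.id ℂ) z
      = s.eval z / q.eval z := by
  have hq : q ≠ 0 := by rintro rfl; simp at hz
  set ω : RatFunc ℂ := algebraMap ℂ[X] (RatFunc ℂ) s / algebraMap ℂ[X] (RatFunc ℂ) q with hω
  have hd : ω.denom.eval z ≠ 0 := by
    obtain ⟨r, hr⟩ := RatFunc.denom_div_dvd s q
    intro h
    apply hz
    rw [hr, eval_mul, h, zero_mul]
  have hk : ω.num * q = s * ω.denom := (RatFunc.num_mul_eq_mul_denom_iff hq).2 hω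
  have := congrArg (eval z) hk
  rw [eval_mul, eval_mul] at this
  rw [RatFunc.eval, eval₂_id, eval₂_id]
  rw [div_eq_div_iff hd hz]
  exact this

theorem ae_onCircle_div (s : ℂ[X]) {q : ℂ[X]} (hq : q ≠ 0) :
    ∀ᵐ t ∂(haarAddCircle (T := 1)),
      onCircle (algebraMap ℂ[X] (RatFunc ℂ) s / algebraMap ℂ[X] (RatFunc ℂ) q) t
        = s.eval (toCircle t : ℂ) / q.eval (toCircle t : ℂ) :=
  (ae_eval_ne_zero hq).mono fun _ ht => eval_div ht

/-- `Rat₀(𝕋)`: the strictly proper rational functions all of whose poles lie on the unit circle. -/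
def IsRat0T (ρ : RatFunc ℂ) : Prop :=
  ∃ s q : ℂ[X], q ≠ 0 ∧ s.degree < q.degree ∧ (∀ α : ℂ, q.IsRoot α → ‖α‖ = 1) ∧
    ρ = algebraMap ℂ[X] (RatFunc ℂ) s / algebraMap ℂ[X] (RatFunc ℂ) q

/-- The definition in terms of the representation in lowest terms. -/
theorem isRat0T_iff {ρ : RatFunc ℂ} : IsRat0T ρ ↔
    ρ.num.degree < ρ.denom.degree ∧ ∀ α : ℂ, ρ.denom.IsRoot α → ‖α‖ = 1 := by
  constructor
  · rintro ⟨s, q, hq, hd, hr, hρ⟩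
    refine ⟨?_, fun α hα => hr α (hα.dvd ?_)⟩
    · have h := congrArg degree ((RatFunc.num_mul_eq_mul_denom_iff hq).2 hρ)
      rw [degree_mul, degree_mul] at h
      by_contra hcon
      rw [not_lt] at hcon
      have hden := degree_eq_natDegree ρ.denom_ne_zero
      have h1 : s.degree + ρ.denom.degree < q.degree + ρ.denom.degree := by
        rw [hden]
        exact WithBot.add_lt_add_right (by simp) hd
      rw [← h, add_comm] at h1
      exact absurd h1 (not_lt.2 (add_le_add_right hcon _))
    · rw [hρ]
      exact RatFunc.denom_div_dvd s q
  · rintro ⟨hd, hr⟩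
    exact ⟨ρ.num, ρ.denom, ρ.denom_ne_zero, hd, hr, (RatFunc.num_div_denom ρ).symm⟩

theorem IsRat0T.zero : IsRat0T 0 :=
  ⟨0, 1, one_ne_zero, by simp, fun α h => by simp [IsRoot] at h, by simp⟩

theorem IsRat0T.add {ρ σ : RatFunc ℂ} (hρ : IsRat0T ρ) (hσ : IsRat0T σ) : IsRat0T (ρ + σ) := by
  obtain ⟨s, q, hq, hd, hr, rfl⟩ := hρ
  obtain ⟨s', q', hq', hd', hr', rfl⟩ := hσ
  refine ⟨s * q' + q * s', q * q', mul_ne_zero hq hq', ?_, fun α h => ?_, ?_⟩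
  · refine (degree_add_le _ _).trans_lt (max_lt ?_ ?_)
    · rw [degree_mul, degree_mul, degree_eq_natDegree hq']
      rw [degree_eq_natDegree hq] at hd ⊢
      exact WithBot.add_lt_add_right (by simp) hd
    · rw [degree_mul, degree_mul, degree_eq_natDegree hq]
      rw [degree_eq_natDegree hq'] at hd' ⊢
      exact WithBot.add_lt_add_left (by simp) hd'
  · rcases (root_mul.1 h) with h | h
    exacts [hr α h, hr' α h]
  · have h1 : algebraMap ℂ[X] (RatFunc ℂ) q ≠ 0 := RatFunc.algebraMap_ne_zero hq
    have h2 : algebraMap ℂ[X] (RatFunc ℂ) q' ≠ 0 := RatFunc.algebraMap_ne_zero hq'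
    simp only [map_add, map_mul]
    field_simp

theorem IsRat0T.smul {ρ : RatFunc ℂ} (c : ℂ) (hρ : IsRat0T ρ) : IsRat0T (RatFunc.C c * ρ) := by
  obtain ⟨s, q, hq, hd, hr, rfl⟩ := hρ
  refine ⟨C c * s, q, hq, ?_, hr, ?_⟩
  · refine lt_of_le_of_lt ?_ hd
    rw [← smul_eq_C_mul]
    exact degree_smul_le c s
  · rw [map_mul, RatFunc.algebraMap_C, mul_div_assoc]

theorem ae_onCircle_add (ρ σ : RatFunc ℂ) :
    ∀ᵐ t ∂(haarAddCircle (T := 1)), onCircle (ρ + σ) t = onCircle ρ t + onCircle σ t := by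
  filter_upwards [ae_eval_ne_zero ρ.denom_ne_zero, ae_eval_ne_zero σ.denom_ne_zero] with t h1 h2
  exact RatFunc.eval_add _ _ (by rwa [eval₂_id]) (by rwa [eval₂_id])

theorem ae_onCircle_smul (c : ℂ) (ρ : RatFunc ℂ) :
    ∀ᵐ t ∂(haarAddCircle (T := 1)), onCircle (RatFunc.C c * ρ) t = c * onCircle ρ t := by
  filter_upwards [ae_eval_ne_zero ρ.denom_ne_zero] with t h1
  refine (RatFunc.eval_mul _ _ (by simp) (by rwa [eval₂_id])).trans ?_
  simp [onCircle]

/-- The function `z ↦ 1 / (z - α)` is not integrable over the circle if `|α| = 1`. -/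
theorem not_integrable_inv_sub {α : ℂ} (hα : ‖α‖ = 1) :
    ¬ Integrable (fun t : UnitAddCircle => ((toCircle t : ℂ) - α)⁻¹) haarAddCircle := by
  intro h
  obtain ⟨t₀, ht₀⟩ : ∃ t₀ : ℝ, (toCircle (t₀ : UnitAddCircle) : ℂ) = α := by
    obtain ⟨θ, hθ⟩ := Circle.exp_surjective ⟨α, mem_sphere_zero_iff_norm.2 hα⟩
    refine ⟨θ / (2 * Real.pi), ?_⟩
    rw [toCircle_apply_mk, div_one, mul_div_cancel₀ _ (by positivity), hθ]
  have hvol : Integrable (fun t : UnitAddCircle => ((toCircle t : ℂ) - α)⁻¹) volume := by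
    rw [volume_eq_smul_haarAddCircle]
    exact h.smul_measure (by simp)
  have hint : IntervalIntegrable (fun x : ℝ => ((toCircle (x : UnitAddCircle) : ℂ) - α)⁻¹)
      volume t₀ (t₀ + 1) := by
    rw [intervalIntegrable_iff_integrableOn_Ioc_of_le (by linarith)]
    exact (AddCircle.measurePreserving_mk 1 t₀).integrable_comp_of_integrable hvol
  refine not_intervalIntegrable_of_sub_inv_isBigO_punctured (c := t₀) ?_ (by simp) (by simp) hint
  have hder := hasDerivAt_fourier (T := 1) 1 t₀
  simp only [fourier_one] at hder
  rw [ht₀] at hder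
  have hne : (2 * Real.pi * Complex.I * ((1 : ℤ) : ℂ) / ((1 : ℝ) : ℂ) * α) ≠ 0 := by
    have hα0 : α ≠ 0 := by rintro rfl; simp at hα
    simp [hα0, Real.pi_ne_zero]
  refine Asymptotics.IsBigO.inv_rev (f := fun x : ℝ => (toCircle (x : UnitAddCircle) : ℂ) - α)
    (g := fun x : ℝ => x - t₀) ?_ ?_
  · have h1 := hder.isBigO_sub
    rw [ht₀] at h1
    exact h1.mono nhdsWithin_le_nhds
  · filter_upwards [hder.eventually_ne (c := α) hne] with x hx h0
    exact absurd (sub_eq_zero.1 h0) hx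

/-- The only function in `Rat₀(𝕋)` that is integrable over the circle is `0`. -/
theorem IsRat0T.eq_zero {ρ : RatFunc ℂ} (hρ : IsRat0T ρ)
    (hi : Integrable (onCircle ρ) haarAddCircle) : ρ = 0 := by
  obtain ⟨s, q, hq, hd, hr, rfl⟩ := hρ
  replace hi := hi.congr (ae_onCircle_div s hq)
  induction hn : q.natDegree generalizing s q with
  | zero =>
    have h0 : s = 0 := by
      rw [eq_C_of_natDegree_eq_zero hn, degree_C (by
        rintro h0; apply hq; rw [eq_C_of_natDegree_eq_zero hn, h0, C_0])] at hd
      exact not_not.1 fun h => not_lt.2 (zero_le_degree_iff.2 h) hd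
    simp [h0]
  | succ n ih =>
    obtain ⟨α, hα⟩ := IsAlgClosed.exists_root q (by
      rw [degree_eq_natDegree hq, hn]; exact_mod_cast n.succ_ne_zero)
    obtain ⟨q₁, rfl⟩ := dvd_iff_isRoot.2 hα
    have hq₁ : q₁ ≠ 0 := right_ne_zero_of_mul hq
    have hXα : (X - C α : ℂ[X]) ≠ 0 := X_sub_C_ne_zero α
    have hn₁ : q₁.natDegree = n := by
      rw [natDegree_mul hXα hq₁, natDegree_X_sub_C] at hn
      omega
    have hα1 : ‖α‖ = 1 := hr α hα
    -- multiply by the bounded function `q₁`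
    have hcont : Continuous (fun t : UnitAddCircle => q₁.eval (toCircle t : ℂ)) :=
      q₁.continuous.comp (continuous_subtype_val.comp continuous_toCircle)
    obtain ⟨B, hB⟩ := (isCompact_range hcont).isBounded.exists_norm_le
    have hi₁ : Integrable (fun t : UnitAddCircle => s.eval (toCircle t : ℂ) *
        ((toCircle t : ℂ) - α)⁻¹) haarAddCircle := by
      refine (hi.bdd_mul (c := B) hcont.aestronglyMeasurable
        (ae_of_all _ fun t => hB _ ⟨t, rfl⟩)).congr ?_
      filter_upwards [ae_eval_ne_zero hq₁, ae_eval_ne_zero hXα] with t h1 h2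
      rw [eval_mul]
      simp only [eval_sub, eval_X, eval_C] at h2 ⊢
      field_simp
    have hsα : s.IsRoot α := by
      by_contra hne
      have hne' : s.eval α ≠ 0 := hne
      obtain ⟨s₁, hs₁⟩ := X_sub_C_dvd_sub_C_eval (a := α) (p := s)
      have hc₁ : Continuous (fun t : UnitAddCircle => s₁.eval (toCircle t : ℂ)) :=
        s₁.continuous.comp (continuous_subtype_val.comp continuous_toCircle)
      have hI₁ : Integrable (fun t : UnitAddCircle => s₁.eval (toCircle t : ℂ)) haarAddCircle :=
        hc₁.integrable_of_hasCompactSupport (HasCompactSupport.of_compactSpace _)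
      apply not_integrable_inv_sub hα1
      refine ((hi₁.sub hI₁).const_mul (s.eval α)⁻¹).congr ?_
      filter_upwards [ae_eval_ne_zero hXα] with t h2
      have h3 := congrArg (eval (toCircle t : ℂ)) hs₁
      simp only [eval_sub, eval_X, eval_C, eval_mul, Pi.sub_apply] at h2 h3 ⊢
      rw [sub_eq_iff_eq_add] at h3
      rw [h3]
      field_simp
      ring
    obtain ⟨s₁, rfl⟩ := dvd_iff_isRoot.2 hsα
    have hX' : algebraMap ℂ[X] (RatFunc ℂ) (X - C α) ≠ 0 := RatFunc.algebraMap_ne_zero hXα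
    have heq : algebraMap ℂ[X] (RatFunc ℂ) ((X - C α) * s₁) /
        algebraMap ℂ[X] (RatFunc ℂ) ((X - C α) * q₁) =
        algebraMap ℂ[X] (RatFunc ℂ) s₁ / algebraMap ℂ[X] (RatFunc ℂ) q₁ := by
      rw [map_mul, map_mul, mul_div_mul_left _ _ hX']
    rw [heq]
    refine ih s₁ q₁ hq₁ ?_ (fun β hβ => hr β (root_mul.2 (Or.inr hβ))) (hi.congr ?_) hn₁
    · rw [degree_mul, degree_mul, degree_X_sub_C] at hd
      exact lt_of_add_lt_add_left hd
    · filter_upwards [ae_eval_ne_zero hXα] with t h2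
      rw [eval_mul, eval_mul, mul_div_mul_left _ _ h2]

/-- The largest order of a pole of `ω` on the unit circle (`0` if there is none); the order of the
pole at `α` is the multiplicity of `α` as a root of the denominator of `ω` in lowest terms. -/
def maxPoleOrder (ω : RatFunc ℂ) : ℕ :=
  open Classical in
  (ω.denom.roots.toFinset.filter fun α => ‖α‖ = 1).sup fun α => ω.denom.rootMultiplicity α

/-! ### The operator -/

/-- The graph of `T_ω`: the pairs `(g, ℙ f)` with `g ∈ H^p` and `ω g = f + ρ` on the circle, where
`f ∈ L^p(𝕋)` and `ρ ∈ Rat₀(𝕋)`. -/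
def toeplitzGraph (p : ℝ≥0∞) [Fact (1 ≤ p)] (ω : RatFunc ℂ) :
    Submodule ℂ (Hardy p × Hardy p) where
  carrier := {x | ∃ (f : LpT p) (ρ : RatFunc ℂ), IsRat0T ρ ∧
    (∀ᵐ t ∂(haarAddCircle (T := 1)), onCircle ω t * (x.1 : LpT p) t = f t + onCircle ρ t) ∧
    x.2 = rieszProj p f}
  zero_mem' := by
    refine ⟨0, 0, IsRat0T.zero, ?_, by simp⟩
    filter_upwards [Lp.coeFn_zero ℂ p (haarAddCircle (T := 1))] with t ht
    simp only [Prod.fst_zero, Submodule.coe_zero, ht]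
    simp [onCircle]
  add_mem' := by
    rintro ⟨g, h⟩ ⟨g', h'⟩ ⟨f, ρ, hρ, he, hh⟩ ⟨f', ρ', hρ', he', hh'⟩
    refine ⟨f + f', ρ + ρ', hρ.add hρ', ?_, ?_⟩
    · filter_upwards [Lp.coeFn_add (g : LpT p) (g' : LpT p), Lp.coeFn_add f f', he, he',
        ae_onCircle_add ρ ρ'] with t h1 h2 h3 h4 h5
      simp only [Prod.mk_add_mk, Submodule.coe_add, Pi.add_apply] at h1 h2 h3 h4 ⊢
      rw [h1, h2, h5, mul_add, h3, h4]
      ring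
    · simp only [Prod.mk_add_mk, map_add] at hh hh' ⊢
      rw [hh, hh']
  smul_mem' := by
    rintro c ⟨g, h⟩ ⟨f, ρ, hρ, he, hh⟩
    refine ⟨c • f, RatFunc.C c * ρ, hρ.smul c, ?_, ?_⟩
    · filter_upwards [Lp.coeFn_smul c (g : LpT p), Lp.coeFn_smul c f, he,
        ae_onCircle_smul c ρ] with t h1 h2 h3 h5
      simp only [Prod.smul_mk, Submodule.coe_smul, Pi.smul_apply, smul_eq_mul] at h1 h2 h3 ⊢
      rw [h1, h2, h5, mul_left_comm, h3]
      ring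
    · simp only [Prod.smul_mk, map_smul] at hh ⊢
      rw [hh]

/-- `T_ω` is well defined. -/
theorem toeplitzGraph_functional (p : ℝ≥0∞) [Fact (1 ≤ p)] (ω : RatFunc ℂ)
    (x : Hardy p × Hardy p) (hx : x ∈ toeplitzGraph p ω) (h0 : x.1 = 0) : x.2 = 0 := by
  obtain ⟨f, ρ, hρ, he, hh⟩ := hx
  have he' : (fun t => -f t) =ᵐ[haarAddCircle] onCircle ρ := by
    filter_upwards [he, Lp.coeFn_zero ℂ p (haarAddCircle (T := 1))] with t h1 h2
    rw [h0, Submodule.coe_zero, h2, Pi.zero_apply, mul_zero] at h1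
    rw [neg_eq_iff_add_eq_zero, h1]
  have hz : ρ = 0 := hρ.eq_zero (f.integrable.neg.congr he')
  have hf : f = 0 := by
    refine Lp.eq_zero_iff_ae_eq_zero.2 (he'.mono fun t ht => ?_)
    rw [hz] at ht
    simpa [onCircle] using ht
  rw [hh, hf, map_zero]

/-- The Toeplitz-like operator `T_ω (H^p → H^p)` with
`Dom(T_ω) = {g ∈ H^p | ω g = f + ρ with f ∈ L^p(𝕋), ρ ∈ Rat₀(𝕋)}` and `T_ω g = ℙ f`. -/
def toeplitz (p : ℝ≥0∞) [Fact (1 ≤ p)] (ω : RatFunc ℂ) : Hardy p →ₗ.[ℂ] Hardy p :=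
  (toeplitzGraph p ω).toLinearPMap

theorem mem_toeplitz_domain {p : ℝ≥0∞} [Fact (1 ≤ p)] {ω : RatFunc ℂ} {g : Hardy p} :
    g ∈ (toeplitz p ω).domain ↔ ∃ (f : LpT p) (ρ : RatFunc ℂ), IsRat0T ρ ∧
      ∀ᵐ t ∂(haarAddCircle (T := 1)), onCircle ω t * (g : LpT p) t = f t + onCircle ρ t := by
  constructor
  · rintro ⟨x, ⟨f, ρ, hρ, he, -⟩, rfl⟩
    exact ⟨f, ρ, hρ, he⟩
  · rintro ⟨f, ρ, hρ, he⟩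
    exact ⟨(g, rieszProj p f), ⟨f, ρ, hρ, he, rfl⟩, rfl⟩

theorem toeplitz_apply {p : ℝ≥0∞} [Fact (1 ≤ p)] {ω : RatFunc ℂ} (g : (toeplitz p ω).domain)
    {f : LpT p} {ρ : RatFunc ℂ} (hρ : IsRat0T ρ)
    (he : ∀ᵐ t ∂(haarAddCircle (T := 1)),
      onCircle ω t * ((g : Hardy p) : LpT p) t = f t + onCircle ρ t) :
    toeplitz p ω g = rieszProj p f := by
  have hg : ((g : Hardy p), rieszProj p f) ∈ (toeplitz p ω).graph := by
    have h := Submodule.toLinearPMap_graph_eq _ (toeplitzGraph_functional p ω)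
    rw [show (toeplitz p ω).graph = toeplitzGraph p ω from h]
    exact ⟨f, ρ, hρ, he, rfl⟩
  exact ((toeplitz p ω).mem_graph_iff.1 hg).elim fun y hy => by
    have hyg : y = g := Subtype.ext hy.1
    rw [← hyg]
    exact hy.2

/-- The monomial `z ^ n` as an element of `H^p`. -/
def monomialH (p : ℝ≥0∞) [Fact (1 ≤ p)] (n : ℕ) : Hardy p :=
  ⟨fourierLp p (n : ℤ), mem_hardy.2 fun m hm => by
    rw [fourierCoeff_congr_ae (coeFn_fourierLp p n), fourierCoeff_fourier]
    exact Pi.single_eq_of_ne (by omega) _⟩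

/-- `A` is the matrix of the operator `T` with respect to the standard (Schauder) basis
`{z ^ n}_{n ≥ 0}` of `H^p`: every `z ^ n` lies in the domain of `T`, and
`T z ^ n = ∑_{m ≥ 0} A m n • z ^ m`, the partial sums converging in the norm of `H^p`. -/
def IsMatrixOf {p : ℝ≥0∞} [Fact (1 ≤ p)] (A : Matrix ℕ ℕ ℂ) (T : Hardy p →ₗ.[ℂ] Hardy p) :
    Prop :=
  ∀ n : ℕ, ∃ hn : monomialH p n ∈ T.domain,
    Tendsto (fun N : ℕ => ∑ m ∈ Finset.range N, A m n • monomialH p m) atTop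
      (𝓝 (T ⟨monomialH p n, hn⟩))

end

end ToeplitzLike

open ToeplitzLike

namespace ToeplitzLike

/-! ### Fourier coefficients and the Riesz projection of absolutely convergent series -/

/-! Modulo `Rat₀(𝕋)`, every `ω z ^ n` turns out to be an absolutely convergent Fourier series. On
such a series `ℙ` merely deletes the terms of negative index, because the two halves of the series
converge in `L^p` to elements of `H^p` and of `K^p` (`hasSum_rieszProj`). The matrix can therefore
be read off from Fourier coefficients, and only the shift by `n` has to be checked; this is recorded
by `IsSymbol`.

Having a symbol with the required growth is a linear condition on `ω`, so partial fractions reduce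
the theorem to polynomials and to the fractions `(z - α) ^ (-(k + 1))`. A pole off the circle gives
an absolutely convergent Laurent series, in powers of `1 / z` if `‖α‖ < 1` and in powers of `z` if
`‖α‖ > 1`. For a pole on the circle, divide `z ^ n` by `(z - α) ^ (k + 1)`: the remainder
contributes an element of `Rat₀(𝕋)`, and the quotient is a polynomial in which the coefficient of `z
^ m` is `(l.choose k) α ^ (l - k)` with `l = n - 1 - m ≥ 0` (`X_pow_eq`, `coeff_polyPart`). It
depends only on `m - n` and is `O(l ^ k)`, where `k + 1` is at most the order of the pole. Hence
only poles on the circle cause growth of `a (-j)`. -/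

theorem norm_fourier_apply (n : ℤ) (t : UnitAddCircle) : ‖(fourier n t : ℂ)‖ = 1 := by
  rw [fourier_apply]
  exact Circle.norm_coe _

/-- The measure has total mass one, so the `L^1` norm is at most the `L^p` norm. Continuity of the
coefficients makes `Hardy p` and `HardyCompl p` closed, hence stable under infinite sums. -/
theorem norm_coeffL_le {p : ℝ≥0∞} [Fact (1 ≤ p)] (n : ℤ) (f : LpT p) :
    ‖coeffL p n f‖ ≤ 1 * ‖f‖ := by
  have h1 : ‖coeffL p n f‖ ≤ ∫ t, ‖f t‖ ∂(haarAddCircle (T := 1)) := by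
    refine norm_integral_le_of_norm_le f.integrable.norm (ae_of_all _ fun t => ?_)
    rw [norm_smul, norm_fourier_apply, one_mul]
  rw [one_mul]
  refine h1.trans ?_
  rw [integral_norm_eq_lintegral_enorm f.integrable.aestronglyMeasurable,
    ← eLpNorm_one_eq_lintegral_enorm, Lp.norm_def]
  exact ENNReal.toReal_mono (Lp.eLpNorm_ne_top f)
    (eLpNorm_le_eLpNorm_of_exponent_le Fact.out f.integrable.aestronglyMeasurable)

theorem isClosed_ker_coeffL {p : ℝ≥0∞} [Fact (1 ≤ p)] (n : ℤ) :
    IsClosed (LinearMap.ker (coeffL p n) : Set (LpT p)) :=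
  ((coeffL p n).mkContinuous 1 (norm_coeffL_le n)).isClosed_ker

theorem isClosed_hardy (p : ℝ≥0∞) [Fact (1 ≤ p)] : IsClosed (Hardy p : Set (LpT p)) := by
  rw [Hardy, Submodule.coe_iInf]
  exact isClosed_iInter fun n => isClosed_ker_coeffL _

theorem isClosed_hardyCompl (p : ℝ≥0∞) [Fact (1 ≤ p)] :
    IsClosed (HardyCompl p : Set (LpT p)) := by
  rw [HardyCompl, Submodule.coe_iInf]
  exact isClosed_iInter fun n => isClosed_ker_coeffL _

theorem fourierLp_mem_hardyCompl (p : ℝ≥0∞) [Fact (1 ≤ p)] {n : ℤ} (hn : n < 0) :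
    (fourierLp p n : LpT p) ∈ HardyCompl p :=
  mem_hardyCompl.2 fun m hm => by
    rw [fourierCoeff_congr_ae (coeFn_fourierLp p n), fourierCoeff_fourier]
    exact Pi.single_eq_of_ne (by omega) _

theorem summable_smul_fourier {c : ℤ → ℂ} (hc : Summable fun k => ‖c k‖) :
    Summable fun k => c k • (fourier k : C(UnitAddCircle, ℂ)) :=
  Summable.of_norm (by simpa only [norm_smul, fourier_norm, mul_one] using hc)

/-- The series converges uniformly, and the inclusion of continuous functions into `L^p` is
continuous and linear. -/
theorem hasSum_toLp_fourier (p : ℝ≥0∞) [Fact (1 ≤ p)] {c : ℤ → ℂ} (hc : Summable fun k => ‖c k‖) :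
    HasSum (fun k => c k • (fourierLp p k : LpT p))
      (ContinuousMap.toLp p haarAddCircle ℂ (∑' k, c k • fourier k)) := by
  have h := (summable_smul_fourier hc).hasSum.mapL (ContinuousMap.toLp (E := ℂ) p (haarAddCircle (T := 1)) ℂ)
  simpa only [map_smul] using h

theorem ae_toLp_fourier (p : ℝ≥0∞) [Fact (1 ≤ p)] {c : ℤ → ℂ} (hc : Summable fun k => ‖c k‖) :
    ∀ᵐ t ∂(haarAddCircle (T := 1)),
      (ContinuousMap.toLp (E := ℂ) p haarAddCircle ℂ (∑' k, c k • fourier k)) t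
        = ∑' k, c k * fourier k t := by
  filter_upwards [ContinuousMap.coeFn_toLp (p := p) (𝕜 := ℂ) (haarAddCircle (T := 1))
    (∑' k, c k • (fourier k : C(UnitAddCircle, ℂ)))] with t ht
  rw [ht, ← ContinuousMap.tsum_apply (summable_smul_fourier hc)]
  rfl

/-- The Riesz projection cuts off the negative part of an absolutely convergent Fourier series. -/
theorem hasSum_rieszProj {p : ℝ≥0∞} [Fact (1 ≤ p)] {c : ℤ → ℂ} {f : LpT p}
    (hf : HasSum (fun k => c k • (fourierLp p k : LpT p)) f) :
    HasSum (fun m : ℕ => c m • monomialH p m) (rieszProj p f) := by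
  have hsum : ∀ e : ℕ → ℤ, Function.Injective e →
      Summable fun m => c (e m) • (fourierLp p (e m) : LpT p) := fun e he =>
    hf.summable.comp_injective he
  obtain ⟨u, hu⟩ := hsum (fun m => (m : ℤ)) Nat.cast_injective
  obtain ⟨v, hv⟩ := hsum (fun m => -((m : ℤ) + 1)) fun a b h => by simpa using h
  have huH : u ∈ Hardy p := (isClosed_hardy p).mem_of_tendsto hu
    (Eventually.of_forall fun s => (Hardy p).sum_mem fun m _ =>
      (Hardy p).smul_mem _ (monomialH p m).2)
  have hvK : v ∈ HardyCompl p := (isClosed_hardyCompl p).mem_of_tendsto hv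
    (Eventually.of_forall fun s => (HardyCompl p).sum_mem fun m _ =>
      (HardyCompl p).smul_mem _ (fourierLp_mem_hardyCompl p (by omega)))
  have hfuv : f = u + v := hf.unique (HasSum.of_nat_of_neg_add_one hu hv)
  -- The two properties in `IsRiesz` determine the value at `u + v`; continuity of the projection
  -- plays no role.
  have hP : rieszProj p f = ⟨u, huH⟩ := by
    rw [hfuv, map_add, (rieszProj_spec p).2 v hvK, add_zero]
    exact (rieszProj_spec p).1 ⟨u, huH⟩
  rw [hP, HasSum, Topology.IsInducing.subtypeVal.tendsto_nhds_iff]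
  refine hu.congr fun s => ?_
  simp [monomialH]

/-! ### Symbols -/

/-- `a` is the sequence of diagonals of `T_ω`: each `ω z ^ n` is, up to an element of `Rat₀(𝕋)`, the
sum of an absolutely convergent Fourier series whose coefficients of nonnegative index are those
of `a` shifted by `n`. -/
def IsSymbol (ω : RatFunc ℂ) (a : ℤ → ℂ) : Prop :=
  ∀ n : ℕ, ∃ (c : ℤ → ℂ) (ρ : RatFunc ℂ), (Summable fun k => ‖c k‖) ∧ IsRat0T ρ ∧
    (∀ᵐ t ∂(haarAddCircle (T := 1)),
      onCircle ω t * fourier n t = ∑' k, c k * fourier k t + onCircle ρ t) ∧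
    ∀ m : ℕ, c m = a (m - n)

/-- Any admissible decomposition `f + ρ` computes `T_ω`, so one convenient choice for each `n`
suffices. Unconditional summability then yields convergence of the ordered partial sums. -/
theorem isMatrixOf_toeplitz {p : ℝ≥0∞} [Fact (1 ≤ p)] {ω : RatFunc ℂ} {A : Matrix ℕ ℕ ℂ}
    (h : ∀ n : ℕ, ∃ (f : LpT p) (ρ : RatFunc ℂ), IsRat0T ρ ∧
      (∀ᵐ t ∂(haarAddCircle (T := 1)),
        onCircle ω t * (monomialH p n : LpT p) t = f t + onCircle ρ t) ∧
      HasSum (fun m => A m n • monomialH p m) (rieszProj p f)) :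
    IsMatrixOf A (toeplitz p ω) := by
  intro n
  obtain ⟨f, ρ, hρ, he, hs⟩ := h n
  have hn : monomialH p n ∈ (toeplitz p ω).domain := mem_toeplitz_domain.2 ⟨f, ρ, hρ, he⟩
  have hT : toeplitz p ω ⟨monomialH p n, hn⟩ = rieszProj p f :=
    toeplitz_apply ⟨monomialH p n, hn⟩ hρ he
  exact ⟨hn, hT ▸ hs.tendsto_sum_nat⟩

theorem IsSymbol.isMatrixOf {ω : RatFunc ℂ} {a : ℤ → ℂ} (h : IsSymbol ω a) (p : ℝ≥0∞)
    [Fact (1 ≤ p)] :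
    IsMatrixOf (Matrix.of fun m n : ℕ => a ((m : ℤ) - (n : ℤ))) (toeplitz p ω) := by
  refine isMatrixOf_toeplitz fun n => ?_
  obtain ⟨c, ρ, hc, hρ, he, ha⟩ := h n
  refine ⟨_, ρ, hρ, ?_, (hasSum_rieszProj (hasSum_toLp_fourier p hc)).congr_fun ?_⟩
  · filter_upwards [he, ae_toLp_fourier p hc, coeFn_fourierLp (T := 1) p (n : ℤ)] with t h1 h2 h3
    rw [h2, ← h1, ← h3]
    rfl
  · intro m
    rw [Matrix.of_apply, ha]

theorem summable_mul_fourier {c : ℤ → ℂ} (hc : Summable fun k => ‖c k‖) (t : UnitAddCircle) :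
    Summable fun k => c k * fourier k t :=
  Summable.of_norm (by simpa only [norm_mul, norm_fourier_apply, mul_one] using hc)

theorem IsSymbol.add {ω ω' : RatFunc ℂ} {a a' : ℤ → ℂ} (h : IsSymbol ω a) (h' : IsSymbol ω' a') :
    IsSymbol (ω + ω') (a + a') := by
  intro n
  obtain ⟨c, ρ, hc, hρ, he, ha⟩ := h n
  obtain ⟨c', ρ', hc', hρ', he', ha'⟩ := h' n
  refine ⟨c + c', ρ + ρ', (hc.add hc').of_nonneg_of_le (fun _ => norm_nonneg _)
    (fun k => norm_add_le _ _), hρ.add hρ', ?_, fun m => by simp [ha, ha']⟩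
  filter_upwards [he, he', ae_onCircle_add ω ω', ae_onCircle_add ρ ρ'] with t h1 h2 h3 h4
  simp only [Pi.add_apply, add_mul]
  rw [(summable_mul_fourier hc t).tsum_add (summable_mul_fourier hc' t), h3, h4, add_mul, h1, h2]
  ring

theorem IsSymbol.smul {ω : RatFunc ℂ} {a : ℤ → ℂ} (z : ℂ) (h : IsSymbol ω a) :
    IsSymbol (RatFunc.C z * ω) (z • a) := by
  intro n
  obtain ⟨c, ρ, hc, hρ, he, ha⟩ := h n
  refine ⟨z • c, RatFunc.C z * ρ, by simpa [norm_smul] using hc.mul_left ‖z‖, hρ.smul z, ?_,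
    fun m => by simp [ha]⟩
  filter_upwards [he, ae_onCircle_smul z ω, ae_onCircle_smul z ρ] with t h1 h3 h4
  simp only [Pi.smul_apply, smul_eq_mul, mul_assoc]
  rw [tsum_mul_left, h3, h4, mul_assoc, h1]
  ring

/-- A function with absolutely convergent Fourier series has its Fourier coefficients as symbol. -/
theorem IsSymbol.of_summable {ω : RatFunc ℂ} {a : ℤ → ℂ} (ha : Summable fun k => ‖a k‖)
    (h : ∀ᵐ t ∂(haarAddCircle (T := 1)), HasSum (fun k => a k * fourier k t) (onCircle ω t)) :
    IsSymbol ω a := by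
  intro n
  -- Multiplication by `z ^ n` translates the coefficients by `n`, and no correction from `Rat₀(𝕋)`
  -- is needed.
  refine ⟨fun k => a (k - n), 0, ?_, IsRat0T.zero, ?_, fun m => rfl⟩
  · exact ha.comp_injective (sub_left_injective (b := (n : ℤ)))
  · filter_upwards [h] with t ht
    have h2 := (Equiv.subRight (n : ℤ)).hasSum_iff.2 ht
    have h3 := (h2.mul_right (fourier n t)).tsum_eq
    rw [← h3]
    simp only [onCircle, RatFunc.eval_zero, add_zero]
    refine tsum_congr fun k => ?_
    simp only [Function.comp_apply, Equiv.subRight_apply, mul_assoc, ← fourier_add, sub_add_cancel]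

/-- `ω` has a symbol with the growth `O(j ^ (M - 1))` at `-∞` that is square summable at `∞`. -/
def HasSymbol (M : ℕ) (ω : RatFunc ℂ) : Prop :=
  ∃ a : ℤ → ℂ, IsSymbol ω a ∧
    (∃ C : ℝ, ∀ j : ℕ, 1 ≤ j → ‖a (-(j : ℤ))‖ ≤ C * (j : ℝ) ^ ((M : ℤ) - 1)) ∧
    Memℓp (fun j : ℕ => a (j : ℤ)) 2

theorem HasSymbol.add {M : ℕ} {ω ω' : RatFunc ℂ} (h : HasSymbol M ω) (h' : HasSymbol M ω') :
    HasSymbol M (ω + ω') := by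
  obtain ⟨a, ha, ⟨C, hC⟩, hl⟩ := h
  obtain ⟨a', ha', ⟨C', hC'⟩, hl'⟩ := h'
  refine ⟨a + a', ha.add ha', ⟨C + C', fun j hj => ?_⟩, hl.add hl'⟩
  rw [add_mul]
  exact (norm_add_le _ _).trans (add_le_add (hC j hj) (hC' j hj))

theorem HasSymbol.smul {M : ℕ} {ω : RatFunc ℂ} (z : ℂ) (h : HasSymbol M ω) :
    HasSymbol M (RatFunc.C z * ω) := by
  obtain ⟨a, ha, ⟨C, hC⟩, hl⟩ := h
  refine ⟨z • a, ha.smul z, ⟨‖z‖ * C, fun j hj => ?_⟩, hl.const_smul z⟩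
  rw [Pi.smul_apply, norm_smul, mul_assoc]
  exact mul_le_mul_of_nonneg_left (hC j hj) (norm_nonneg z)

/-- The sequence with the values `u 0, u 1, …` at `0, 1, …` and `v 0, v 1, …` at `-1, -2, …`. -/
def glue (u v : ℕ → ℂ) (k : ℤ) : ℂ :=
  if 0 ≤ k then u k.toNat else v (-k - 1).toNat

@[simp] theorem glue_natCast (u v : ℕ → ℂ) (n : ℕ) : glue u v n = u n := by simp [glue]

@[simp] theorem glue_neg (u v : ℕ → ℂ) (n : ℕ) : glue u v (-((n : ℤ) + 1)) = v n := by
  rw [glue, if_neg (by omega)]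
  congr 1
  omega

theorem summable_norm_glue {u v : ℕ → ℂ} (hu : Summable fun n => ‖u n‖)
    (hv : Summable fun n => ‖v n‖) : Summable fun k => ‖glue u v k‖ :=
  Summable.of_nat_of_neg_add_one (by simpa only [glue_natCast] using hu)
    (by simpa only [glue_neg] using hv)

theorem fourier_natCast (n : ℕ) (t : UnitAddCircle) :
    fourier (n : ℤ) t = (toCircle t : ℂ) ^ n := by
  rw [fourier_apply, toCircle_zsmul]
  simp

theorem fourier_neg_natCast_add_one (n : ℕ) (t : UnitAddCircle) :
    fourier (-((n : ℤ) + 1)) t = (toCircle t : ℂ)⁻¹ ^ (n + 1) := by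
  rw [fourier_apply, toCircle_zsmul, zpow_neg, ← Nat.cast_succ, zpow_natCast]
  simp

theorem hasSum_glue {u v : ℕ → ℂ} {t : UnitAddCircle} {x y : ℂ}
    (hu : HasSum (fun n => u n * (toCircle t : ℂ) ^ n) x)
    (hv : HasSum (fun n => v n * (toCircle t : ℂ)⁻¹ ^ (n + 1)) y) :
    HasSum (fun k => glue u v k * fourier k t) (x + y) :=
  HasSum.of_nat_of_neg_add_one (by simpa only [glue_natCast, fourier_natCast] using hu)
    (by simpa only [glue_neg, fourier_neg_natCast_add_one] using hv)

/-- Growth and summability of a symbol given by its two halves. -/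
theorem HasSymbol.of_glue {M : ℕ} {ω : RatFunc ℂ} {u v : ℕ → ℂ} (h : IsSymbol ω (glue u v))
    (hu : Summable fun n => ‖u n‖) {C : ℝ}
    (hv : ∀ n : ℕ, ‖v n‖ ≤ C * ((n : ℝ) + 1) ^ ((M : ℤ) - 1)) : HasSymbol M ω := by
  refine ⟨_, h, ⟨C, fun j hj => ?_⟩, ?_⟩
  · obtain ⟨n, rfl⟩ := Nat.exists_eq_add_of_le' hj
    simpa only [Nat.cast_add, Nat.cast_one, glue_neg] using hv n
  -- The nonnegative half is even in `ℓ^1`, which is contained in `ℓ^2`.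
  · have h1 : Memℓp u 1 := memℓp_gen (by simpa using hu)
    simpa using h1.of_exponent_ge one_le_two

theorem summable_norm_coeff (P : ℂ[X]) : Summable fun n => ‖P.coeff n‖ := by
  refine summable_of_ne_finset_zero (s := P.support) fun n hn => ?_
  simpa using hn

theorem hasSum_coeff (P : ℂ[X]) (z : ℂ) : HasSum (fun n => P.coeff n * z ^ n) (P.eval z) := by
  rw [eval_eq_sum, Polynomial.sum]
  refine hasSum_sum_of_ne_finset_zero fun n hn => ?_
  rw [notMem_support_iff.1 hn, zero_mul]

theorem HasSymbol.polynomial (M : ℕ) (P : ℂ[X]) : HasSymbol M (algebraMap ℂ[X] (RatFunc ℂ) P) := by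
  refine HasSymbol.of_glue (u := P.coeff) (v := 0) (C := 0) (IsSymbol.of_summable
    (summable_norm_glue (summable_norm_coeff P) (by simp)) ?_)
    (summable_norm_coeff P) (by simp)
  refine ae_of_all _ fun t => ?_
  have h := hasSum_glue (v := 0) (y := 0) (hasSum_coeff P (toCircle t : ℂ))
    (by simp)
  simpa [onCircle, RatFunc.eval_algebraMap] using h

/-! ### Simple fractions -/

/-- This is the binomial series with its index moved by `k`. The terms with `n < k` vanish through
the binomial coefficient, so the truncated exponent `n - k` is harmless. -/
theorem hasSum_choose_mul_pow_sub (k : ℕ) {x w : ℂ} (h : ‖x * w‖ < 1) :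
    HasSum (fun n : ℕ => (n.choose k : ℂ) * x ^ (n - k) * w ^ n) (w ^ k / (1 - x * w) ^ (k + 1)) := by
  have h1 := (hasSum_choose_mul_geometric_of_norm_lt_one k h).mul_left (w ^ k)
  rw [← hasSum_nat_add_iff' k, Finset.sum_eq_zero fun n hn => by
    rw [Nat.choose_eq_zero_of_lt (Finset.mem_range.1 hn), Nat.cast_zero, zero_mul, zero_mul],
    sub_zero]
  rw [mul_one_div] at h1
  refine h1.congr_fun fun n => ?_
  rw [Nat.add_sub_cancel, mul_pow, pow_add]
  ring

theorem summable_norm_choose_mul_pow_sub (k : ℕ) {x : ℂ} (h : ‖x‖ < 1) :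
    Summable fun n : ℕ => ‖(n.choose k : ℂ) * x ^ (n - k)‖ := by
  simpa using (hasSum_choose_mul_pow_sub k (x := x) (w := 1) (by simpa using h)).summable.norm

/-- Since `(n + 1) * n.choose k = (k + 1) * (n + 1).choose (k + 1)`, the `n`-th term times `n + 1`
equals, in norm, `k + 1` times a term of the convergent series for `k + 1`, and so is bounded by `k
+ 1` times the sum of norms of that series. -/
theorem norm_choose_mul_pow_sub_le (k : ℕ) {x : ℂ} (h : ‖x‖ < 1) :
    ∃ C : ℝ, 0 ≤ C ∧ ∀ n : ℕ, ‖(n.choose k : ℂ) * x ^ (n - k)‖ ≤ C * ((n : ℝ) + 1)⁻¹ := by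
  have hs := summable_norm_choose_mul_pow_sub (k + 1) h
  refine ⟨((k : ℝ) + 1) * ∑' n : ℕ, ‖(n.choose (k + 1) : ℂ) * x ^ (n - (k + 1))‖,
    mul_nonneg (by positivity) (tsum_nonneg fun n => norm_nonneg _), fun n => ?_⟩
  rw [← div_eq_mul_inv, le_div_iff₀ (by positivity)]
  have hle := hs.le_tsum (n + 1) fun j _ => norm_nonneg _
  refine le_trans (le_of_eq ?_) (mul_le_mul_of_nonneg_left hle (by positivity))
  have hch : ((n : ℝ) + 1) * n.choose k = (n + 1).choose (k + 1) * ((k : ℝ) + 1) := by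
    exact_mod_cast Nat.add_one_mul_choose_eq n k
  rw [norm_mul, norm_mul, Complex.norm_natCast, Complex.norm_natCast, Nat.add_sub_add_right]
  linear_combination ‖x ^ (n - k)‖ * hch

theorem ae_onCircle_inv_pow (α : ℂ) (k : ℕ) :
    ∀ᵐ t ∂(haarAddCircle (T := 1)),
      onCircle ((algebraMap ℂ[X] (RatFunc ℂ) (X - C α))⁻¹ ^ k) t
        = 1 / ((toCircle t : ℂ) - α) ^ k := by
  have h := ae_onCircle_div 1 (pow_ne_zero k (X_sub_C_ne_zero α))
  simpa [← inv_pow] using h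

/-! ### Poles off the circle. -/

/-- Expansion at infinity: `(z - α) ^ (-(k + 1)) = z⁻¹ ^ (k + 1) * (1 - α z⁻¹) ^ (-(k + 1))`, in
which only negative powers of `z` occur. -/
theorem HasSymbol.inv_pow_of_norm_lt_one (M : ℕ) {α : ℂ} (hα : ‖α‖ < 1) (k : ℕ) :
    HasSymbol M ((algebraMap ℂ[X] (RatFunc ℂ) (X - C α))⁻¹ ^ (k + 1)) := by
  obtain ⟨B, hB0, hB⟩ := norm_choose_mul_pow_sub_le k hα
  refine HasSymbol.of_glue (u := 0) (v := fun n => (n.choose k : ℂ) * α ^ (n - k)) (C := B)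
    (IsSymbol.of_summable (summable_norm_glue (by simp) (summable_norm_choose_mul_pow_sub k hα)) ?_)
    (by simp) fun n => (hB n).trans ?_
  · filter_upwards [ae_onCircle_inv_pow α (k + 1)] with t ht
    have hz : ‖(toCircle t : ℂ)‖ = 1 := Circle.norm_coe _
    generalize hw : (toCircle t : ℂ) = z at *
    have hz0 : z ≠ 0 := by rintro rfl; simp at hz
    have h := (hasSum_choose_mul_pow_sub k (x := α) (w := z⁻¹) (by simpa [hz] using hα)).mul_right
      z⁻¹
    have h2 := hasSum_glue (u := 0) (x := 0) (t := t) (by simp)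
      (h.congr_fun (g := fun n => (n.choose k : ℂ) * α ^ (n - k) * (toCircle t : ℂ)⁻¹ ^ (n + 1))
        fun n => by rw [hw, pow_succ]; ring)
    convert h2 using 1
    rw [ht, zero_add, div_mul_eq_mul_div, ← pow_succ,
      show z - α = z * (1 - α * z⁻¹) by field_simp, mul_pow, one_div, mul_inv, ← inv_pow z,
      div_eq_mul_inv]
  -- The strictest requirement is `M = 0`, where the bound is `(n + 1)⁻¹`; every larger `M` follows
  -- from it.
  · refine mul_le_mul_of_nonneg_left ?_ hB0
    rw [← zpow_neg_one]
    exact zpow_le_zpow_right₀ (by simp) (by omega)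

/-- Taylor expansion at the origin: `(z - α) ^ (-(k + 1)) = (-α)⁻¹ ^ (k + 1) * (1 - z / α) ^ (-(k +
1))`. The negative half is zero. -/
theorem HasSymbol.inv_pow_of_one_lt_norm (M : ℕ) {α : ℂ} (hα : 1 < ‖α‖) (k : ℕ) :
    HasSymbol M ((algebraMap ℂ[X] (RatFunc ℂ) (X - C α))⁻¹ ^ (k + 1)) := by
  have hα' : ‖α⁻¹‖ < 1 := by
    rw [norm_inv]
    exact inv_lt_one_of_one_lt₀ hα
  have hα0 : α ≠ 0 := by rintro rfl; simp at hα; linarith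
  have hs : Summable fun n : ℕ => ‖(-α)⁻¹ ^ (k + 1) * (((n + k).choose k : ℂ) * α⁻¹ ^ n)‖ :=
    ((hasSum_choose_mul_geometric_of_norm_lt_one k hα').summable.mul_left _).norm
  refine HasSymbol.of_glue (u := fun n => (-α)⁻¹ ^ (k + 1) * (((n + k).choose k : ℂ) * α⁻¹ ^ n))
    (v := 0) (C := 0) (IsSymbol.of_summable (summable_norm_glue hs (by simp)) ?_) hs (by simp)
  filter_upwards [ae_onCircle_inv_pow α (k + 1)] with t ht
  have hz : ‖(toCircle t : ℂ)‖ = 1 := Circle.norm_coe _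
  have h := (hasSum_choose_mul_geometric_of_norm_lt_one k (r := α⁻¹ * (toCircle t : ℂ))
    (by rwa [norm_mul, hz, mul_one])).mul_left ((-α)⁻¹ ^ (k + 1))
  have h2 := hasSum_glue (v := 0) (y := 0) (t := t)
    (h.congr_fun (g := fun n => (-α)⁻¹ ^ (k + 1) * (((n + k).choose k : ℂ) * α⁻¹ ^ n)
      * (toCircle t : ℂ) ^ n) fun n => by rw [mul_pow]; ring) (by simp)
  convert h2 using 1
  generalize (toCircle t : ℂ) = z at *
  rw [ht, add_zero, ← one_div_pow, ← one_div_pow, ← mul_pow, ← one_div, one_div_mul_one_div]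
  congr 3
  field_simp
  ring

/-! ### Poles on the circle: division of `X ^ n` by `(X - α) ^ (k + 1)`. -/

/-- The polynomial part of `X ^ n / (X - α) ^ (k + 1)`. -/
noncomputable def polyPart (α : ℂ) (k : ℕ) : ℕ → ℂ[X]
  | 0 => 0
  | n + 1 => X * polyPart α k n + C ((n.choose k : ℂ) * α ^ (n - k))

/-- Each step of the recursion moves the coefficients up by one and inserts a new constant term, so
the coefficient depends only on `n - 1 - m`. This is the source of the Toeplitz structure. -/
theorem coeff_polyPart (α : ℂ) (k n m : ℕ) : (polyPart α k n).coeff m =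
    if m < n then ((n - 1 - m).choose k : ℂ) * α ^ (n - 1 - m - k) else 0 := by
  induction n generalizing m with
  | zero => simp [polyPart]
  | succ n ih =>
    cases m with
    | zero => simp [polyPart, -map_pow]
    | succ m =>
      simp only [polyPart, coeff_add, coeff_X_mul, ih, coeff_C_succ, add_zero, add_lt_add_iff_right,
        Nat.add_sub_cancel]
      rw [Nat.sub_sub, add_comm 1 m]

/-- The remainder of `X ^ n` modulo `(X - α) ^ (k + 1)`, as a Taylor polynomial. -/
noncomputable def taylorPart (α : ℂ) (k n : ℕ) : ℂ[X] :=
  ∑ i ∈ Finset.range (k + 1), C ((n.choose i : ℂ) * α ^ (n - i)) * (X - C α) ^ i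

theorem degree_taylorPart_lt (α : ℂ) (k n : ℕ) :
    (taylorPart α k n).degree < ((X - C α) ^ (k + 1)).degree := by
  rw [degree_pow, degree_X_sub_C, nsmul_one]
  refine (degree_sum_le _ _).trans_lt ((Finset.sup_lt_iff (WithBot.bot_lt_coe _)).2 fun i hi => ?_)
  rw [C_mul']
  refine (degree_smul_le _ _).trans_lt ?_
  rw [degree_pow, degree_X_sub_C, nsmul_one]
  exact_mod_cast Finset.mem_range.1 hi

/-- Write `X = (X - α) + α`. The top term overflows into `(X - α) ^ (k + 1)`, and Pascal's rule
recombines the others into the remainder for `n + 1`. The overflow is exactly the constant term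
added in `polyPart`. -/
theorem X_mul_taylorPart (α : ℂ) (k n : ℕ) : X * taylorPart α k n =
    C ((n.choose k : ℂ) * α ^ (n - k)) * (X - C α) ^ (k + 1) + taylorPart α k (n + 1) := by
  induction k with
  | zero =>
    simp only [taylorPart, zero_add, Finset.sum_range_one, Nat.choose_zero_right, Nat.sub_zero,
      map_mul, map_pow, Nat.cast_one, map_one]
    ring
  | succ k ih =>
    have hstep : ∀ m, taylorPart α (k + 1) m = taylorPart α k m
        + C ((m.choose (k + 1) : ℂ) * α ^ (m - (k + 1))) * (X - C α) ^ (k + 1) := fun m =>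
      Finset.sum_range_succ _ _
    -- For `n ≤ k` the truncated exponents do not match, but then the binomial coefficient is zero.
    have hpow : (n.choose (k + 1) : ℂ) * α ^ (n - k) =
        (n.choose (k + 1) : ℂ) * (α ^ (n - (k + 1)) * α) := by
      rcases lt_or_ge k n with h | h
      · rw [← pow_succ]
        congr 2
        omega
      · rw [Nat.choose_eq_zero_of_lt (by omega), Nat.cast_zero, zero_mul, zero_mul]
    rw [hstep, hstep, mul_add, ih, Nat.choose_succ_succ, Nat.add_sub_add_right, Nat.cast_add,
      add_mul, hpow]
    simp only [map_add, map_mul]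
    ring

theorem X_pow_eq (α : ℂ) (k n : ℕ) :
    (X : ℂ[X]) ^ n = polyPart α k n * (X - C α) ^ (k + 1) + taylorPart α k n := by
  induction n with
  | zero =>
    rw [polyPart, zero_mul, zero_add, taylorPart, Finset.sum_range_succ']
    simp
  | succ n ih =>
    rw [pow_succ', ih, mul_add, X_mul_taylorPart, polyPart]
    ring

/-- The diagonals are the coefficients of the formal expansion at infinity, as for a pole inside the
disc. That series is not absolutely convergent here, but for each `n` only the finitely many
coefficients of the quotient enter. -/
theorem isSymbol_inv_pow_of_norm_eq_one {α : ℂ} (hα : ‖α‖ = 1) (k : ℕ) :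
    IsSymbol ((algebraMap ℂ[X] (RatFunc ℂ) (X - C α))⁻¹ ^ (k + 1))
      (glue 0 fun n => (n.choose k : ℂ) * α ^ (n - k)) := by
  intro n
  have hq : (X - C α : ℂ[X]) ^ (k + 1) ≠ 0 := pow_ne_zero _ (X_sub_C_ne_zero α)
  refine ⟨glue (polyPart α k n).coeff 0, algebraMap ℂ[X] (RatFunc ℂ) (taylorPart α k n) /
    algebraMap ℂ[X] (RatFunc ℂ) ((X - C α) ^ (k + 1)),
    summable_norm_glue (summable_norm_coeff _) (by simp),
    ⟨_, _, hq, degree_taylorPart_lt α k n, fun β hβ => ?_, rfl⟩, ?_, fun m => ?_⟩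
  · have h := pow_eq_zero_iff (k.succ_ne_zero) |>.1 ((eval_pow (k + 1)).symm.trans hβ)
    rw [eval_sub, eval_X, eval_C, sub_eq_zero] at h
    rwa [h]
  · filter_upwards [ae_onCircle_inv_pow α (k + 1), ae_onCircle_div (taylorPart α k n) hq,
      ae_eval_ne_zero hq] with t h1 h2 h3
    have h4 := (hasSum_glue (v := 0) (y := 0) (hasSum_coeff (polyPart α k n) (toCircle t : ℂ))
      (by simp)).tsum_eq
    have h5 := congrArg (eval (toCircle t : ℂ)) (X_pow_eq α k n)
    rw [h4, h1, h2, fourier_natCast]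
    simp only [eval_pow, eval_X, eval_add, eval_mul, eval_sub, eval_C] at h3 h5 ⊢
    rw [h5]
    field_simp
    ring
  -- For `m < n` put `l = n - 1 - m`, so that `m - n = -(l + 1)` is the place where `glue` stores
  -- its entry `l`. For `m ≥ n` both sides are zero.
  · rw [glue_natCast, coeff_polyPart]
    split_ifs with hmn
    · obtain ⟨l, rfl⟩ := Nat.exists_eq_add_of_lt hmn
      rw [show ((m : ℤ) - ((m + l + 1 : ℕ) : ℤ)) = -((l : ℤ) + 1) by push_cast; ring, glue_neg,
        show m + l + 1 - 1 - m = l by omega]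
    · obtain ⟨l, rfl⟩ := Nat.exists_eq_add_of_le (not_lt.1 hmn)
      rw [show (((n + l : ℕ) : ℤ) - (n : ℤ)) = (l : ℤ) by push_cast; ring, glue_natCast]
      rfl

/-- As `‖α‖ = 1`, the coefficient has norm `n.choose k ≤ (n + 1) ^ k`, and `k ≤ M - 1`. -/
theorem HasSymbol.inv_pow_of_norm_eq_one {M : ℕ} {α : ℂ} (hα : ‖α‖ = 1) {k : ℕ} (hk : k + 1 ≤ M) :
    HasSymbol M ((algebraMap ℂ[X] (RatFunc ℂ) (X - C α))⁻¹ ^ (k + 1)) := by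
  refine HasSymbol.of_glue (C := 1) (isSymbol_inv_pow_of_norm_eq_one hα k) (by simp) fun n => ?_
  rw [norm_mul, norm_pow, hα, one_pow, mul_one, one_mul, Complex.norm_natCast]
  calc (n.choose k : ℝ) ≤ (n : ℝ) ^ k := by exact_mod_cast Nat.choose_le_pow n k
    _ ≤ ((n : ℝ) + 1) ^ k := by gcongr; simp
    _ = ((n : ℝ) + 1) ^ (k : ℤ) := (zpow_natCast _ _).symm
    _ ≤ _ := zpow_le_zpow_right₀ (by simp) (by omega)

theorem HasSymbol.inv_pow {M : ℕ} {α : ℂ} {k : ℕ} (hk : ‖α‖ = 1 → k + 1 ≤ M) :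
    HasSymbol M ((algebraMap ℂ[X] (RatFunc ℂ) (X - C α))⁻¹ ^ (k + 1)) := by
  rcases lt_trichotomy ‖α‖ 1 with h | h | h
  exacts [.inv_pow_of_norm_lt_one M h k, .inv_pow_of_norm_eq_one h (hk h),
    .inv_pow_of_one_lt_norm M h k]

/-! ### Partial fractions and assembly. -/

theorem HasSymbol.sum {M : ℕ} {ι : Type*} {s : Finset ι} {ω : ι → RatFunc ℂ}
    (h : ∀ i ∈ s, HasSymbol M (ω i)) : HasSymbol M (∑ i ∈ s, ω i) :=
  Finset.sum_induction _ (HasSymbol M) (fun _ _ => HasSymbol.add)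
    (by simpa using HasSymbol.polynomial M 0) h

theorem hasSymbol_maxPoleOrder (ω : RatFunc ℂ) : HasSymbol (maxPoleOrder ω) ω := by
  classical
  have hprod : ω.denom = ∏ α ∈ ω.denom.roots.toFinset, (X - C α) ^ ω.denom.rootMultiplicity α := by
    rw [← prod_multiset_root_eq_finset_root]
    exact (IsAlgClosed.splits _).eq_prod_roots_of_monic ω.monic_denom
  obtain ⟨q, r, hr, he⟩ := mul_prod_pow_inverse_eq_quo_add_sum_rem_mul_pow_inverse
    (K := RatFunc ℂ) (s := ω.denom.roots.toFinset) ω.num (g := fun α => X - C α)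
    (fun α _ => monic_X_sub_C α)
    ((pairwise_coprime_X_sub_C Function.injective_id).set_pairwise _)
    (fun α => ω.denom.rootMultiplicity α)
    (gi := fun α => (algebraMap ℂ[X] (RatFunc ℂ) (X - C α))⁻¹)
    (fun α _ => inv_mul_cancel₀ (RatFunc.algebraMap_ne_zero (X_sub_C_ne_zero α)))
  have hω : ω = algebraMap ℂ[X] (RatFunc ℂ) ω.num * ∏ α ∈ ω.denom.roots.toFinset,
      (algebraMap ℂ[X] (RatFunc ℂ) (X - C α))⁻¹ ^ ω.denom.rootMultiplicity α := by
    conv_lhs => rw [← RatFunc.num_div_denom ω]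
    rw [div_eq_mul_inv]
    congr 1
    conv_lhs => rw [hprod]
    simp only [map_prod, map_pow, inv_pow, Finset.prod_inv_distrib]
  have key : HasSymbol (maxPoleOrder ω) (algebraMap ℂ[X] (RatFunc ℂ) q +
      ∑ α ∈ ω.denom.roots.toFinset, ∑ j, algebraMap ℂ[X] (RatFunc ℂ) (r α j) *
        (algebraMap ℂ[X] (RatFunc ℂ) (X - C α))⁻¹ ^ (j.1 + 1)) := by
    refine (HasSymbol.polynomial _ q).add (HasSymbol.sum fun α hα => HasSymbol.sum fun j _ => ?_)
    have hd := hr α hα j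
    rw [degree_X_sub_C] at hd
    -- The factors `X - C α` have degree one, so the numerators are constants.
    rw [eq_C_of_degree_le_zero (Order.le_of_lt_succ hd), RatFunc.algebraMap_C]
    refine HasSymbol.smul _ (HasSymbol.inv_pow fun h1 => (Nat.succ_le_of_lt j.2).trans ?_)
    -- The exponent `j + 1` is at most the multiplicity of `α`, which for `‖α‖ = 1` is one of the
    -- numbers whose maximum is `maxPoleOrder ω`.
    exact Finset.le_sup (f := fun α => ω.denom.rootMultiplicity α) (Finset.mem_filter.2 ⟨hα, h1⟩)
  rwa [← he, ← hω] at key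

end ToeplitzLike

theorem theorem1p3 (p : ℝ≥0∞) [Fact (1 ≤ p)] (hp1 : 1 < p) (hp : p < ∞) (ω : RatFunc ℂ) :
    ∃ a : ℤ → ℂ,
      IsMatrixOf (Matrix.of fun m n : ℕ => a ((m : ℤ) - (n : ℤ))) (toeplitz p ω) ∧
      (∃ C : ℝ, ∀ j : ℕ, 1 ≤ j →
        ‖a (-(j : ℤ))‖ ≤ C * (j : ℝ) ^ ((maxPoleOrder ω : ℤ) - 1)) ∧
      Memℓp (fun j : ℕ => a (j : ℤ)) 2 := by
  obtain ⟨a, ha, h⟩ := hasSymbol_maxPoleOrder ω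
  exact ⟨a, ha.isMatrixOf p, h⟩
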